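/- Let $X$ be a Cantor set (a topological space homeomorphic to the middle-thirds Cantor set) and let $\mathrm{Homeo}(X)$ be the group of all homeomorphisms of $X$ onto itself. Call $T\in \mathrm{Homeo}(X)$ aperiodic if $T^n x\neq x$ for all $x\in X$ and all integers $n\ge 1$, and let $\mathcal{A}p$ be the set of all aperiodic homeomorphisms of $X$. For $S,T\in \mathrm{Homeo}(X)$ put $E(S,T)=\{x\in X: Tx\ne Sx\}\cup\{x\in X: S^{-1}x\neq T^{-1}x\}$, and for Borel probability measures $\mu_1,\dots,\mu_p$ on $X$ and $\varepsilon>0$ put $$U(T;\mu_1,\dots,\mu_p;\varepsilon)=\{S\in \mathrm{Homeo}(X): \mu_i(E(S,T))<\varepsilon,\ i=1,\dots,p\}.$$ Let $\tau$ be the topology on $\mathrm{Homeo}(X)$ generated by all these sets (they form a base of it). Let $S\in\mathcal{A}p$. Then for every $R\in\mathcal{A}p$, all Borel probability measures $\mu_1,\dots,\mu_p$ on $X$ and every $\varepsilon>0$ there exists $T\in \mathrm{Homeo}(X)$ such that $T^{-1}ST\in U(R;\mu_1,\dots,\mu_p;\varepsilon)$. Moreover, $\mathcal{A}p$ is equal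 to the $\tau$-closure of $\{T^{-1}ST : T\in \mathrm{Homeo}(X)\}$. -/

import Mathlib

open MeasureTheory
open scoped Topology

namespace CantorDynamics

/-- `X` is a Cantor set: it is homeomorphic to the middle-thirds Cantor set. -/
def IsCantor (X : Type*) [TopologicalSpace X] : Prop :=
  Nonempty (X ≃ₜ cantorSet)

section Homeo

variable {X : Type*} [TopologicalSpace X]

/-- A homeomorphism is aperiodic if it has no periodic points, that is, if all its orbits are
infinite. -/
def IsAperiodic (T : X ≃ₜ X) : Prop :=
  ∀ n : ℕ, 0 < n → ∀ x : X, (T ^ n) x ≠ x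

/-- The set `E(S, T)` of the points at which `S` and `T`, or their inverses, differ. -/
def diffSet (S T : X ≃ₜ X) : Set X :=
  {x | T x ≠ S x} ∪ {x | S⁻¹ x ≠ T⁻¹ x}

/-- The set `U(T; μ₁, …, μₚ; ε)`. -/
def basicNhd [MeasurableSpace X] (T : X ≃ₜ X) {p : ℕ} (μ : Fin p → ProbabilityMeasure X) (ε : ℝ) :
    Set (X ≃ₜ X) :=
  {S | ∀ i, (μ i : Measure X).real (diffSet S T) < ε}

variable (X) in
/-- The uniform topology `τ` on the homeomorphisms of `X`: the topology generated by the
sets `U(T; μ₁, …, μₚ; ε)` with `ε > 0`. -/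
abbrev uniformTopology [MeasurableSpace X] : TopologicalSpace (X ≃ₜ X) :=
  TopologicalSpace.generateFrom
    {U | ∃ (T : X ≃ₜ X) (p : ℕ) (μ : Fin p → ProbabilityMeasure X) (ε : ℝ),
      0 < ε ∧ U = basicNhd T μ ε}

end Homeo

end CantorDynamics

/-! Cut the space into towers for `R`. A clopen marker set `A` whose visits along every `R`-orbit
are well separated but have bounded gaps gives each point a height, the time since its last visit to
`A`. Choose a clopen `B` whose first `S`-images are disjoint, and a homeomorphism `H` taking `A` to
`B`. On height `i` put `T = S ^ i * H * R ^ (-i)`, leaving the top level undefined. Then `T * R = S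
* T` at every point such that neither it nor its `R`-image is on top
(`IsCantor.exists_conj_diffSet_subset`).

Two facts make this work. In a Cantor set all nonempty proper clopen sets are equivalent under
homeomorphisms, so the partial map `T` extends (`IsCantor.exists_homeomorph_eq_on`). And the
exceptional set is three consecutive preimages of `A`; with long return times, averaging over
translates of `A` makes it small for all given measures
(`IsAperiodic.exists_isClopen_marker_measure_lt`).

This gives density of the conjugacy class. Conversely, a periodic orbit is detected by finitely many
Dirac masses, so aperiodicity is a closed condition. -/

namespace CantorDynamics

/-! ### Clopen subsets of the space of binary sequences -/

section CantorSpace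

/-- The sequence with first term `b`, followed by `x`. -/
def seqCons (b : Bool) (x : ℕ → Bool) : ℕ → Bool
  | 0 => b
  | i + 1 => x i

/-- The sequence `x` without its first term. -/
def seqTail (x : ℕ → Bool) : ℕ → Bool := fun i => x (i + 1)

theorem seqCons_seqTail (x : ℕ → Bool) : seqCons (x 0) (seqTail x) = x := by
  funext i; cases i <;> rfl

theorem seqCons_inj {b b' : Bool} {x x' : ℕ → Bool} (h : seqCons b x = seqCons b' x') :
    b = b' ∧ x = x' :=
  ⟨congrFun h 0, funext fun i => congrFun h (i + 1)⟩

theorem continuous_seqCons (b : Bool) : Continuous (seqCons b) := by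
  refine continuous_pi fun i => ?_
  cases i with
  | zero => exact continuous_const
  | succ i => exact continuous_apply i

/-- Maps depending on the first term of a sequence, applied to its tail, glue to a continuous
map. -/
theorem continuous_glue_seqTail {Y : Type*} [TopologicalSpace Y] {F : Bool → (ℕ → Bool) → Y}
    (hF : ∀ b, Continuous (F b)) : Continuous fun x : ℕ → Bool => F (x 0) (seqTail x) := by
  have h : Continuous fun p : Bool × (ℕ → Bool) => F p.1 p.2 :=
    continuous_prod_of_discrete_left.2 hF
  have h' : Continuous fun x : ℕ → Bool => (x 0, seqTail x) :=
    (continuous_apply 0).prodMk (continuous_pi fun i => continuous_apply (i + 1))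
  exact h.comp h'

/-- A nonempty set of sequences determined by finitely many terms is an injective continuous image
of the space of all sequences. -/
theorem exists_range_eq_of_forall_lt (n : ℕ) :
    ∀ U : Set (ℕ → Bool), U.Nonempty →
      (∀ x y : ℕ → Bool, (∀ i < n, x i = y i) → x ∈ U → y ∈ U) →
      ∃ f : (ℕ → Bool) → ℕ → Bool, Continuous f ∧ Function.Injective f ∧ Set.range f = U := by
  induction n with
  | zero =>
    rintro U ⟨x, hx⟩ h
    refine ⟨id, continuous_id, Function.injective_id, ?_⟩
    rw [Set.range_id, eq_comm, Set.eq_univ_iff_forall]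
    exact fun y => h x y (by simp) hx
  | succ n ih =>
    intro U hU h
    have part : ∀ b, (seqCons b ⁻¹' U).Nonempty → ∃ f : (ℕ → Bool) → ℕ → Bool,
        Continuous f ∧ Function.Injective f ∧ Set.range f = seqCons b ⁻¹' U := by
      intro b hb
      refine ih _ hb fun x y hxy hx => h _ _ ?_ hx
      intro i hi
      cases i with
      | zero => rfl
      | succ i => exact hxy i (by omega)
    have tail_mem : ∀ x ∈ U, seqTail x ∈ seqCons (x 0) ⁻¹' U := by
      intro x hx
      rwa [Set.mem_preimage, seqCons_seqTail]
    -- If both halves are nonempty, the first term of the input selects the half; otherwise the one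
    -- nonempty half is all of `U`.
    by_cases hne : ∀ b, (seqCons b ⁻¹' U).Nonempty
    · choose f hc hi hr using fun b => part b (hne b)
      refine ⟨fun x => seqCons (x 0) (f (x 0) (seqTail x)),
        continuous_glue_seqTail (F := fun b y => seqCons b (f b y))
          fun b => (continuous_seqCons b).comp (hc b), ?_, ?_⟩
      · intro x y e
        obtain ⟨e0, e1⟩ := seqCons_inj e
        rw [← e0] at e1
        rw [← seqCons_seqTail x, ← seqCons_seqTail y, hi _ e1, e0]
      · apply Set.Subset.antisymm
        · rintro _ ⟨x, rfl⟩
          have : f (x 0) (seqTail x) ∈ seqCons (x 0) ⁻¹' U := hr (x 0) ▸ Set.mem_range_self _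
          exact this
        · intro x hx
          have := tail_mem x hx
          rw [← hr] at this
          obtain ⟨y, hy⟩ := this
          refine ⟨seqCons (x 0) y, ?_⟩
          change seqCons (x 0) (f (x 0) y) = x
          rw [hy, seqCons_seqTail]
    · push Not at hne
      obtain ⟨b, hb⟩ := hne
      have head_eq : ∀ x ∈ U, x 0 = !b := by
        intro x hx
        by_contra e
        have e' : x 0 = b := by revert e; cases b <;> cases x 0 <;> simp
        have := tail_mem x hx
        rw [e', hb] at this
        exact this
      obtain ⟨f, hc, hi, hr⟩ := part (!b) (by
        obtain ⟨x, hx⟩ := hU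
        exact ⟨_, head_eq x hx ▸ tail_mem x hx⟩)
      refine ⟨seqCons (!b) ∘ f, (continuous_seqCons _).comp hc,
        fun x y e => hi (seqCons_inj e).2, ?_⟩
      rw [Set.range_comp, hr, Set.image_preimage_eq_iff]
      intro x hx
      exact ⟨seqTail x, by rw [← head_eq x hx, seqCons_seqTail]⟩

/-- Membership in a clopen set of sequences is determined by finitely many terms. -/
theorem exists_forall_lt_of_isClopen {U : Set (ℕ → Bool)} (hU : IsClopen U) :
    ∃ n : ℕ, ∀ x y : ℕ → Bool, (∀ i < n, x i = y i) → x ∈ U → y ∈ U := by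
  have cyl_open : ∀ (x : ℕ → Bool) (n : ℕ), IsOpen {y : ℕ → Bool | ∀ i < n, x i = y i} := by
    intro x n
    have : {y : ℕ → Bool | ∀ i < n, x i = y i} = ⋂ i ∈ Finset.range n, {y | x i = y i} := by
      ext; simp
    rw [this]
    refine isOpen_biInter_finset fun i _ => ?_
    exact (isOpen_discrete {b | x i = b}).preimage (continuous_apply i)
  have key : ∀ x ∈ U, ∃ n : ℕ, {y : ℕ → Bool | ∀ i < n, x i = y i} ⊆ U := by
    intro x hx
    obtain ⟨I, u, hu, hsub⟩ := isOpen_pi_iff.1 hU.isOpen x hx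
    refine ⟨I.sup id + 1, fun y hy => hsub fun i hi => ?_⟩
    rw [← hy i (Nat.lt_succ_of_le (Finset.le_sup (f := id) hi))]
    exact (hu i hi).2
  choose! N hN using key
  obtain ⟨t, htU, ht⟩ := hU.isClosed.isCompact.elim_nhds_subcover
    (fun x => {y | ∀ i < N x, x i = y i}) fun x _ => (cyl_open x _).mem_nhds (by simp)
  refine ⟨t.sup N, fun x y hxy hx => ?_⟩
  obtain ⟨z, hz, hzx⟩ := Set.mem_iUnion₂.1 (ht hx)
  refine hN z (htU z hz) fun i hi => ?_
  rw [← hxy i (hi.trans_le (Finset.le_sup (f := N) hz))]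
  exact hzx i hi

/-- A clopen set with nonempty complement is, up to a homeomorphism, the set of the sequences with
first term `true`. -/
theorem exists_homeomorph_mem_iff {U : Set (ℕ → Bool)} (hU : IsClopen U) (h1 : U.Nonempty)
    (h2 : Uᶜ.Nonempty) :
    ∃ φ : (ℕ → Bool) ≃ₜ (ℕ → Bool), ∀ x, φ x ∈ U ↔ x 0 = true := by
  obtain ⟨n, hn⟩ := exists_forall_lt_of_isClopen hU
  obtain ⟨f, hfc, hfi, hfr⟩ := exists_range_eq_of_forall_lt n U h1 hn
  obtain ⟨g, hgc, hgi, hgr⟩ := exists_range_eq_of_forall_lt n Uᶜ h2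
    fun x y h hx hy => hx (hn y x (fun i hi => (h i hi).symm) hy)
  have hf : ∀ x, f x ∈ U := fun x => hfr ▸ Set.mem_range_self x
  have hg : ∀ x, g x ∉ U := fun x => by
    have : g x ∈ Uᶜ := hgr ▸ Set.mem_range_self x
    exact this
  let F : Bool → (ℕ → Bool) → ℕ → Bool := fun b => bif b then f else g
  have hF : ∀ b x, F b x ∈ U ↔ b = true := by
    intro b x
    cases b <;> simp [F, hf, hg]
  have hFi : ∀ b, Function.Injective (F b) := by
    intro b
    cases b <;> assumption
  have hcont : Continuous fun x : ℕ → Bool => F (x 0) (seqTail x) :=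
    continuous_glue_seqTail fun b => by cases b <;> assumption
  have hbij : Function.Bijective fun x : ℕ → Bool => F (x 0) (seqTail x) := by
    constructor
    · intro x y (e : F (x 0) (seqTail x) = F (y 0) (seqTail y))
      have e0 : x 0 = y 0 := by
        rw [Bool.eq_iff_iff, ← hF (x 0) (seqTail x), e, hF]
      rw [← e0] at e
      rw [← seqCons_seqTail x, ← seqCons_seqTail y, hFi _ e, e0]
    · intro y
      by_cases hy : y ∈ U
      · obtain ⟨x, rfl⟩ := hfr.symm ▸ hy
        exact ⟨seqCons true x, rfl⟩
      · obtain ⟨x, rfl⟩ : y ∈ Set.range g := hgr.symm ▸ hy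
        exact ⟨seqCons false x, rfl⟩
  exact ⟨Continuous.homeoOfEquivCompactToT2 (f := Equiv.ofBijective _ hbij) hcont,
    fun x => hF _ _⟩

end CantorSpace

/-! ### Extending partial homeomorphisms of a Cantor set -/

section IsCantor

variable {X : Type*} [TopologicalSpace X]

theorem IsCantor.nonempty_homeomorph (hX : IsCantor X) : Nonempty (X ≃ₜ (ℕ → Bool)) :=
  hX.map fun e => e.trans cantorSetHomeomorphNatToBool

theorem IsCantor.compactSpace (hX : IsCantor X) : CompactSpace X :=
  hX.nonempty_homeomorph.elim fun e => e.symm.compactSpace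

theorem IsCantor.t2Space (hX : IsCantor X) : T2Space X :=
  hX.nonempty_homeomorph.elim fun e => e.symm.t2Space

theorem IsCantor.totallyDisconnectedSpace (hX : IsCantor X) : TotallyDisconnectedSpace X :=
  hX.nonempty_homeomorph.elim fun e => e.symm.totallyDisconnectedSpace

/-- Any two nonempty proper clopen subsets of a Cantor set are exchanged by a homeomorphism of the
Cantor set. -/
theorem IsCantor.exists_homeomorph_mem_iff (hX : IsCantor X) {A B : Set X} (hA : IsClopen A)
    (hA1 : A.Nonempty) (hA2 : Aᶜ.Nonempty) (hB : IsClopen B) (hB1 : B.Nonempty)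
    (hB2 : Bᶜ.Nonempty) : ∃ H : X ≃ₜ X, ∀ x, H x ∈ B ↔ x ∈ A := by
  obtain ⟨e⟩ := hX.nonempty_homeomorph
  have key : ∀ U : Set X, IsClopen U → U.Nonempty → Uᶜ.Nonempty →
      ∃ φ : (ℕ → Bool) ≃ₜ X, ∀ x, φ x ∈ U ↔ x 0 = true := by
    rintro U hU ⟨a, ha⟩ ⟨b, hb⟩
    obtain ⟨φ, hφ⟩ := CantorDynamics.exists_homeomorph_mem_iff (hU.preimage e.symm.continuous)
      ⟨e a, by simpa using ha⟩ ⟨e b, by simpa using hb⟩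
    exact ⟨φ.trans e.symm, hφ⟩
  obtain ⟨φ, hφ⟩ := key A hA hA1 hA2
  obtain ⟨ψ, hψ⟩ := key B hB hB1 hB2
  refine ⟨φ.symm.trans ψ, fun x => ?_⟩
  rw [Homeomorph.trans_apply, hψ, ← hφ, Homeomorph.apply_symm_apply]

/-- Finitely many homeomorphisms that map disjoint clopen sets to disjoint sets agree on these
sets with a single homeomorphism. -/
theorem IsCantor.exists_homeomorph_eq_on (hX : IsCantor X) (m : ℕ) (D : ℕ → Set X)
    (G : ℕ → X ≃ₜ X) (hD : ∀ i < m, IsClopen (D i))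
    (disj : ∀ i < m, ∀ j < m, ∀ x ∈ D i, ∀ y ∈ D j, G i x = G j y → i = j)
    (disj' : ∀ i < m, ∀ j < m, ∀ x ∈ D i, x ∈ D j → i = j)
    (hne : ∃ i < m, (D i).Nonempty) (hc : ∃ x, ∀ i < m, x ∉ D i)
    (hc' : ∃ y, ∀ i < m, ∀ x ∈ D i, G i x ≠ y) :
    ∃ T : X ≃ₜ X, ∀ i < m, ∀ x ∈ D i, T x = G i x := by
  have := hX.compactSpace
  have := hX.t2Space
  classical
  let U : Set X := ⋃ i ∈ Finset.range m, D i
  let W : Set X := ⋃ i ∈ Finset.range m, (G i).symm ⁻¹' D i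
  have hU : IsClopen U := isClopen_biUnion_finset fun i hi => hD i (Finset.mem_range.1 hi)
  have hW : IsClopen W := isClopen_biUnion_finset fun i hi =>
    (hD i (Finset.mem_range.1 hi)).preimage (G i).symm.continuous
  have memU : ∀ x, x ∈ U ↔ ∃ i < m, x ∈ D i := by simp [U]
  have memW : ∀ y, y ∈ W ↔ ∃ i < m, ∃ x ∈ D i, G i x = y := by
    intro y
    simp only [W, Set.mem_iUnion, Finset.mem_range, exists_prop, Set.mem_preimage]
    refine exists_congr fun i => and_congr_right fun _ => ⟨fun h => ⟨_, h, by simp⟩, ?_⟩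
    rintro ⟨x, hx, rfl⟩
    simpa using hx
  obtain ⟨i₀, hi₀, x₀, hx₀⟩ := hne
  obtain ⟨u, hu⟩ := hc
  obtain ⟨w, hw⟩ := hc'
  -- `H` is needed only off `U`, where it maps the complement of the domain onto the complement of
  -- the image.
  obtain ⟨H, hH⟩ := hX.exists_homeomorph_mem_iff hU ⟨x₀, (memU _).2 ⟨i₀, hi₀, hx₀⟩⟩
    ⟨u, fun h => by obtain ⟨i, hi, hx⟩ := (memU _).1 h; exact hu i hi hx⟩ hW
    ⟨G i₀ x₀, (memW _).2 ⟨i₀, hi₀, x₀, hx₀, rfl⟩⟩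
    ⟨w, fun h => by obtain ⟨i, hi, x, hx, e⟩ := (memW _).1 h; exact hw i hi x hx e⟩
  let f : X → X := fun x => if h : ∃ i < m, x ∈ D i then G h.choose x else H x
  have f_eq : ∀ i < m, ∀ x ∈ D i, f x = G i x := by
    intro i hi x hx
    have h : ∃ i < m, x ∈ D i := ⟨i, hi, hx⟩
    have : h.choose = i := disj' _ h.choose_spec.1 _ hi x h.choose_spec.2 hx
    simp only [f, dif_pos h, this]
  have f_eq' : ∀ x ∉ U, f x = H x := fun x hx => dif_neg fun h => hx ((memU x).2 h)
  have hcont : Continuous f := by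
    refine continuous_iff_continuousAt.2 fun x => ?_
    by_cases hx : x ∈ U
    · obtain ⟨i, hi, hxi⟩ := (memU x).1 hx
      refine (G i).continuous.continuousAt.congr ?_
      filter_upwards [(hD i hi).isOpen.mem_nhds hxi] with y hy using (f_eq i hi y hy).symm
    · refine H.continuous.continuousAt.congr ?_
      filter_upwards [hU.compl.isOpen.mem_nhds hx] with y hy using (f_eq' y hy).symm
  have f_mem : ∀ x, f x ∈ W ↔ x ∈ U := by
    intro x
    by_cases hx : x ∈ U
    · obtain ⟨i, hi, hxi⟩ := (memU x).1 hx
      exact iff_of_true (f_eq i hi x hxi ▸ (memW _).2 ⟨i, hi, x, hxi, rfl⟩) hx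
    · rw [f_eq' x hx, hH]
  have hbij : Function.Bijective f := by
    constructor
    · intro x y e
      by_cases hx : x ∈ U
      · have hy : y ∈ U := by rwa [← f_mem, ← e, f_mem]
        obtain ⟨i, hi, hxi⟩ := (memU x).1 hx
        obtain ⟨j, hj, hyj⟩ := (memU y).1 hy
        rw [f_eq i hi x hxi, f_eq j hj y hyj] at e
        obtain rfl := disj i hi j hj x hxi y hyj e
        exact (G i).injective e
      · have hy : y ∉ U := by rwa [← f_mem, ← e, f_mem]
        rw [f_eq' x hx, f_eq' y hy] at e
        exact H.injective e
    · intro y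
      by_cases hy : y ∈ W
      · obtain ⟨i, hi, x, hx, rfl⟩ := (memW y).1 hy
        exact ⟨x, f_eq i hi x hx⟩
      · refine ⟨H.symm y, ?_⟩
        rw [f_eq', H.apply_symm_apply]
        rwa [← hH, H.apply_symm_apply]
  exact ⟨Continuous.homeoOfEquivCompactToT2 (f := Equiv.ofBijective f hbij) hcont,
    fun i hi x hx => f_eq i hi x hx⟩

end IsCantor

/-! ### Marker sets of aperiodic homeomorphisms -/

section Aperiodic

variable {X : Type*} [TopologicalSpace X]

theorem homeo_zpow_add_apply (R : X ≃ₜ X) (i j : ℤ) (x : X) :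
    (R ^ (i + j)) x = (R ^ i) ((R ^ j) x) := by
  rw [zpow_add, Homeomorph.mul_apply]

theorem homeo_zpow_neg_apply_zpow (R : X ≃ₜ X) (i : ℤ) (x : X) : (R ^ (-i)) ((R ^ i) x) = x := by
  rw [← homeo_zpow_add_apply, neg_add_cancel, zpow_zero, Homeomorph.one_apply]

theorem IsAperiodic.zpow_apply_ne {R : X ≃ₜ X} (hR : IsAperiodic R) {i : ℤ} (hi : i ≠ 0) (x : X) :
    (R ^ i) x ≠ x := by
  intro h
  rcases Int.natAbs_eq i with e | e
  · rw [e, zpow_natCast] at h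
    exact hR i.natAbs (by omega) x h
  · have h' := homeo_zpow_neg_apply_zpow R i x
    rw [h, e, neg_neg, zpow_natCast] at h'
    exact hR i.natAbs (by omega) x h'

/-- Every point has a clopen neighbourhood that is disjoint from its images under finitely many
powers of an aperiodic homeomorphism. -/
theorem IsAperiodic.exists_isClopen_disjoint [CompactSpace X] [T2Space X]
    [TotallyDisconnectedSpace X] {R : X ≃ₜ X} (hR : IsAperiodic R) (N : ℤ) (x : X) :
    ∃ U : Set X, IsClopen U ∧ x ∈ U ∧ ∀ y ∈ U, ∀ i : ℤ, i ≠ 0 → |i| < N → (R ^ i) y ∉ U := by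
  have key : ∀ i : ℤ, ∃ V : Set X, IsOpen V ∧ x ∈ V ∧ (i ≠ 0 → ∀ y ∈ V, (R ^ i) y ∉ V) := by
    intro i
    by_cases hi : i = 0
    · exact ⟨Set.univ, isOpen_univ, trivial, fun h => (h hi).elim⟩
    · obtain ⟨u, v, hu, hv, hxu, hxv, huv⟩ := t2_separation (hR.zpow_apply_ne hi x)
      refine ⟨v ∩ (R ^ i) ⁻¹' u, hv.inter (hu.preimage (R ^ i).continuous), ⟨hxv, hxu⟩, ?_⟩
      rintro - y ⟨-, hy⟩ ⟨hy', -⟩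
      exact Set.disjoint_left.1 huv hy hy'
  choose V hVo hxV hV using key
  obtain ⟨U, hU, hxU, hsub⟩ := compact_exists_isClopen_in_isOpen
    (isOpen_biInter_finset (s := Finset.Ioo (-N) N) fun i _ => hVo i)
    (Set.mem_iInter₂.2 fun i _ => hxV i)
  refine ⟨U, hU, hxU, fun y hy i hi hiN hy' => ?_⟩
  have hmem : i ∈ Finset.Ioo (-N) N := Finset.mem_Ioo.2 (abs_lt.1 hiN)
  exact hV i hi y (Set.mem_iInter₂.1 (hsub hy) i hmem) (Set.mem_iInter₂.1 (hsub hy') i hmem)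

theorem isClopen_setOf_exists_zpow_mem (R : X ≃ₜ X) (N : ℤ) {A : Set X} (hA : IsClopen A) :
    IsClopen {x | ∃ i : ℤ, |i| < N ∧ (R ^ i) x ∈ A} := by
  have : {x | ∃ i : ℤ, |i| < N ∧ (R ^ i) x ∈ A} =
      ⋃ i ∈ Finset.Ioo (-N) N, (R ^ i) ⁻¹' A := by
    ext x
    simp [abs_lt]
  rw [this]
  exact isClopen_biUnion_finset fun i _ => hA.preimage (R ^ i).continuous

/-- An aperiodic homeomorphism has a clopen set whose consecutive visits by any orbit are at least
`N` and less than `2 * N` apart. -/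
theorem IsAperiodic.exists_isClopen_marker [CompactSpace X] [T2Space X]
    [TotallyDisconnectedSpace X] {R : X ≃ₜ X} (hR : IsAperiodic R) {N : ℤ} (hN : 0 < N) :
    ∃ A : Set X, IsClopen A ∧ (∀ x ∈ A, ∀ i : ℤ, i ≠ 0 → |i| < N → (R ^ i) x ∉ A) ∧
      ∀ x, ∃ i : ℤ, |i| < N ∧ (R ^ i) x ∈ A := by
  choose U hU hxU hUdisj using hR.exists_isClopen_disjoint N
  have key : ∀ t : Finset X, ∃ A : Set X, IsClopen A ∧
      (∀ x ∈ A, ∀ i : ℤ, i ≠ 0 → |i| < N → (R ^ i) x ∉ A) ∧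
      ∀ z ∈ t, ∀ x ∈ U z, ∃ i : ℤ, |i| < N ∧ (R ^ i) x ∈ A := by
    classical
    intro t
    induction t using Finset.induction_on with
    | empty => exact ⟨∅, isClopen_empty, by simp, by simp⟩
    | insert z t _ ih =>
      obtain ⟨A, hA, hdisj, hcov⟩ := ih
      -- Greedy step: adding only the points of `U z` not yet within reach of `A` keeps the visits
      -- separated and covers all of `U z`.
      refine ⟨A ∪ (U z \ {x | ∃ i : ℤ, |i| < N ∧ (R ^ i) x ∈ A}),
        hA.union ((hU z).diff (isClopen_setOf_exists_zpow_mem R N hA)), ?_, ?_⟩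
      · rintro x (hx | ⟨hx, hx'⟩) i hi hiN (hy | ⟨hy, hy'⟩)
        · exact hdisj x hx i hi hiN hy
        · exact hy' ⟨-i, by rwa [abs_neg], by rwa [homeo_zpow_neg_apply_zpow]⟩
        · exact hx' ⟨i, hiN, hy⟩
        · exact hUdisj z x hx i hi hiN hy
      · intro w hw x hx
        rcases Finset.mem_insert.1 hw with rfl | hw
        · by_cases h : ∃ i : ℤ, |i| < N ∧ (R ^ i) x ∈ A
          · obtain ⟨i, hi, hiA⟩ := h
            exact ⟨i, hi, Or.inl hiA⟩
          · exact ⟨0, by simpa using hN, Or.inr ⟨hx, h⟩⟩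
        · obtain ⟨i, hi, hiA⟩ := hcov w hw x hx
          exact ⟨i, hi, Or.inl hiA⟩
  obtain ⟨t, -, ht⟩ := isCompact_univ.elim_nhds_subcover U
    fun x _ => (hU x).isOpen.mem_nhds (hxU x)
  obtain ⟨A, hA, hdisj, hcov⟩ := key t
  refine ⟨A, hA, hdisj, fun x => ?_⟩
  obtain ⟨z, hz, hzx⟩ := Set.mem_iUnion₂.1 (ht (Set.mem_univ x))
  exact hcov z hz x hzx

/-- A marker set can be moved along orbits, so that three consecutive preimages of it have small
measure. -/
theorem IsAperiodic.exists_isClopen_marker_measure_lt [CompactSpace X] [T2Space X]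
    [TotallyDisconnectedSpace X] [MeasurableSpace X] [BorelSpace X] {R : X ≃ₜ X}
    (hR : IsAperiodic R) {p : ℕ} (μ : Fin p → ProbabilityMeasure X) {ε : ℝ} (hε : 0 < ε) :
    ∃ (N : ℤ) (A : Set X), 2 < N ∧ IsClopen A ∧
      (∀ x ∈ A, ∀ i : ℤ, i ≠ 0 → |i| < N → (R ^ i) x ∉ A) ∧
      (∀ x, ∃ i : ℤ, |i| < N ∧ (R ^ i) x ∈ A) ∧
      ∀ j, (μ j : Measure X).real {x | x ∈ A ∨ R x ∈ A ∨ R (R x) ∈ A} < ε := by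
  -- `K` disjoint blocks have total mass at most `p` over all the measures, so for one block the sum
  -- of its masses is below `ε`. Each block uses three exponents, and separation `3 * K` makes the
  -- blocks disjoint.
  obtain ⟨K, hK⟩ := exists_nat_gt (p / ε)
  have hK0 : 0 < K := by
    have : (0 : ℝ) < K := lt_of_le_of_lt (by positivity) hK
    exact_mod_cast this
  obtain ⟨A, hA, hdisj, hcov⟩ := hR.exists_isClopen_marker (N := 3 * K) (by omega)
  let E : ℕ → Set X := fun k =>
    {x | (R ^ (3 * k : ℤ)) x ∈ A ∨ (R ^ (3 * k + 1 : ℤ)) x ∈ A ∨ (R ^ (3 * k + 2 : ℤ)) x ∈ A}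
  have hEmeas : ∀ k, MeasurableSet (E k) := fun k =>
    ((hA.preimage (R ^ (3 * k : ℤ)).continuous).union
      ((hA.preimage (R ^ (3 * k + 1 : ℤ)).continuous).union
        (hA.preimage (R ^ (3 * k + 2 : ℤ)).continuous))).isOpen.measurableSet
  have hEmem : ∀ k x, x ∈ E k → ∃ i : ℤ, 3 * k ≤ i ∧ i ≤ 3 * k + 2 ∧ (R ^ i) x ∈ A := by
    rintro k x (h | h | h)
    · exact ⟨_, by omega, by omega, h⟩
    · exact ⟨_, by omega, by omega, h⟩
    · exact ⟨_, by omega, by omega, h⟩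
  have hEdisj : Set.PairwiseDisjoint (↑(Finset.range K)) E := by
    intro k hk l hl hkl
    refine Set.disjoint_left.2 fun x hx hx' => ?_
    obtain ⟨i, hi1, hi2, hi⟩ := hEmem k x hx
    obtain ⟨j, hj1, hj2, hj⟩ := hEmem l x hx'
    have hk' := Finset.mem_range.1 (Finset.mem_coe.1 hk)
    have hl' := Finset.mem_range.1 (Finset.mem_coe.1 hl)
    refine hdisj _ hi (j - i) (by omega) (by rw [abs_lt]; omega) ?_
    rwa [← homeo_zpow_add_apply, sub_add_cancel]
  have hsum : ∑ k ∈ Finset.range K, ∑ j, (μ j : Measure X).real (E k) ≤ p := by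
    rw [Finset.sum_comm]
    calc ∑ j, ∑ k ∈ Finset.range K, (μ j : Measure X).real (E k)
        ≤ ∑ j : Fin p, (1 : ℝ) := by
          refine Finset.sum_le_sum fun j _ => ?_
          rw [← measureReal_biUnion_finset hEdisj fun k _ => hEmeas k]
          exact measureReal_le_one
      _ = p := by simp
  obtain ⟨k, hk, hkε⟩ : ∃ k ∈ Finset.range K, ∑ j, (μ j : Measure X).real (E k) < ε := by
    by_contra! h
    have h1 := Finset.card_nsmul_le_sum _ _ _ h
    rw [Finset.card_range, nsmul_eq_mul] at h1
    rw [div_lt_iff₀ hε] at hK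
    linarith
  refine ⟨3 * K, (R ^ (3 * k : ℤ)) ⁻¹' A, by omega, hA.preimage (R ^ (3 * k : ℤ)).continuous,
    ?_, ?_, ?_⟩
  · intro x hx i hi hiN hx'
    refine hdisj _ hx i hi hiN ?_
    rw [Set.mem_preimage, ← homeo_zpow_add_apply, add_comm, homeo_zpow_add_apply] at hx'
    exact hx'
  · intro x
    obtain ⟨i, hi, hx⟩ := hcov ((R ^ (3 * k : ℤ)) x)
    refine ⟨i, hi, ?_⟩
    rwa [Set.mem_preimage, ← homeo_zpow_add_apply, add_comm, homeo_zpow_add_apply]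
  · intro j
    have hE : {x | x ∈ (R ^ (3 * k : ℤ)) ⁻¹' A ∨ R x ∈ (R ^ (3 * k : ℤ)) ⁻¹' A ∨
        R (R x) ∈ (R ^ (3 * k : ℤ)) ⁻¹' A} = E k := by
      ext x
      have e1 : (R ^ (3 * k + 1 : ℤ)) x = (R ^ (3 * k : ℤ)) (R x) := by
        rw [homeo_zpow_add_apply, zpow_one]
      have e2 : (R ^ (3 * k + 2 : ℤ)) x = (R ^ (3 * k : ℤ)) (R (R x)) := by
        rw [homeo_zpow_add_apply, zpow_two, Homeomorph.mul_apply]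
      simp only [E, Set.mem_ofPred_eq, Set.mem_preimage, e1, e2]
    rw [hE]
    refine lt_of_le_of_lt ?_ hkε
    exact Finset.single_le_sum (f := fun j => (μ j : Measure X).real (E k))
      (fun j _ => measureReal_nonneg) (Finset.mem_univ j)

/-! ### Conjugating `S` to agree with `R` along towers -/

/-- An aperiodic homeomorphism has a conjugate that agrees with another aperiodic homeomorphism
`R` away from a given marker set of `R` and its first preimages. -/
theorem IsCantor.exists_conj_diffSet_subset (hX : IsCantor X) {S R : X ≃ₜ X} (hS : IsAperiodic S)
    {N : ℤ} (hN : 2 < N) {A : Set X} (hA : IsClopen A)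
    (hdisj : ∀ x ∈ A, ∀ i : ℤ, i ≠ 0 → |i| < N → (R ^ i) x ∉ A)
    (hcov : ∀ x, ∃ i : ℤ, |i| < N ∧ (R ^ i) x ∈ A) :
    ∃ T : X ≃ₜ X, diffSet (T⁻¹ * S * T) R ⊆ {x | x ∈ A ∨ R x ∈ A ∨ R (R x) ∈ A} := by
  have := hX.compactSpace
  have := hX.t2Space
  have := hX.totallyDisconnectedSpace
  obtain ⟨e⟩ := hX.nonempty_homeomorph
  have x₀ : X := e.symm fun _ => true
  -- A window of radius less than `N` centred `N - 1` steps in the past contains a visit to `A` at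
  -- most `2 * N - 2` steps ago, so heights are below `m`.
  obtain ⟨m, hm⟩ : ∃ m : ℕ, (m : ℤ) = 2 * N := ⟨(2 * N).toNat, by omega⟩
  have hback : ∀ x, ∃ i : ℕ, i < m ∧ (R ^ (-i : ℤ)) x ∈ A := by
    intro x
    obtain ⟨i, hi, hiA⟩ := hcov ((R ^ (-(N - 1))) x)
    rw [abs_lt] at hi
    refine ⟨(N - 1 - i).toNat, by omega, ?_⟩
    rw [← homeo_zpow_add_apply] at hiA
    convert hiA using 3
    omega
  obtain ⟨a, ha⟩ : A.Nonempty := by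
    obtain ⟨i, -, h⟩ := hcov x₀
    exact ⟨_, h⟩
  have hRa : R a ∉ A := by
    have := hdisj a ha 1 one_ne_zero (by rw [abs_one]; omega)
    rwa [zpow_one] at this
  -- The bound `m + 1` makes the images of `B` under exponents `0` to `m` disjoint; the last one is
  -- unused by the levels and supplies a point outside the image.
  obtain ⟨B, hB, hxB, hBdisj⟩ := hS.exists_isClopen_disjoint (m + 1) x₀
  obtain ⟨H, hH⟩ := hX.exists_homeomorph_mem_iff hA ⟨a, ha⟩ ⟨R a, hRa⟩ hB ⟨x₀, hxB⟩
    ⟨S x₀, by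
      have := hBdisj x₀ hxB 1 one_ne_zero (by rw [abs_one]; omega)
      rwa [zpow_one] at this⟩
  -- Points of height `i` off the top level `R ⁻¹' A`; `G i` descends to `A`, crosses to `B` and
  -- climbs along `S`.
  let D : ℕ → Set X := fun i =>
    {x | R x ∉ A ∧ (R ^ (-i : ℤ)) x ∈ A ∧ ∀ k < i, (R ^ (-k : ℤ)) x ∉ A}
  let G : ℕ → X ≃ₜ X := fun i => S ^ (i : ℤ) * H * R ^ (-i : ℤ)
  have hGD : ∀ i, ∀ x ∈ D i, ∃ b ∈ B, G i x = (S ^ (i : ℤ)) b := fun i x hx =>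
    ⟨H ((R ^ (-i : ℤ)) x), (hH _).2 hx.2.1, rfl⟩
  have hcovD : ∀ x, R x ∉ A → ∃ i < m, x ∈ D i := by
    classical
    intro x hx
    have h : ∃ i : ℕ, (R ^ (-i : ℤ)) x ∈ A := (hback x).imp fun i hi => hi.2
    refine ⟨Nat.find h, ?_, hx, Nat.find_spec h, fun k hk => Nat.find_min h hk⟩
    obtain ⟨i, him, hi⟩ := hback x
    exact (Nat.find_min' h hi).trans_lt him
  have hglue : ∃ T : X ≃ₜ X, ∀ i < m, ∀ x ∈ D i, T x = G i x := by
    refine hX.exists_homeomorph_eq_on m D G ?_ ?_ ?_ ?_ ?_ ?_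
    · intro i _
      have : D i = (R ⁻¹' A)ᶜ ∩ ((R ^ (-i : ℤ)) ⁻¹' A ∩
          ⋂ k ∈ Finset.range i, ((R ^ (-k : ℤ)) ⁻¹' A)ᶜ) := by
        ext x
        simp [D]
      rw [this]
      exact (hA.preimage R.continuous).compl.inter ((hA.preimage (R ^ (-i : ℤ)).continuous).inter
        (isClopen_biInter_finset fun k _ => (hA.preimage (R ^ (-k : ℤ)).continuous).compl))
    · intro i hi j hj x hx y hy exy
      obtain ⟨b, hb, hbx⟩ := hGD i x hx
      obtain ⟨c, hc, hcy⟩ := hGD j y hy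
      by_contra hij
      rw [hbx, hcy] at exy
      refine hBdisj b hb (i - j) (by omega) (by rw [abs_lt]; omega) ?_
      rw [sub_eq_neg_add, homeo_zpow_add_apply, exy, homeo_zpow_neg_apply_zpow]
      exact hc
    · intro i hi j hj x hx hx'
      rcases lt_trichotomy i j with h | h | h
      · exact (hx'.2.2 i h hx.2.1).elim
      · exact h
      · exact (hx.2.2 j h hx'.2.1).elim
    · obtain ⟨i, hi, h⟩ := hcovD a hRa
      exact ⟨i, hi, a, h⟩
    · exact ⟨R⁻¹ a, fun i _ h => h.1 (by simpa using ha)⟩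
    · refine ⟨(S ^ (m : ℤ)) x₀, fun i hi x hx exy => ?_⟩
      obtain ⟨b, hb, hbx⟩ := hGD i x hx
      rw [hbx] at exy
      refine hBdisj b hb (i - m) (by omega) (by rw [abs_lt]; omega) ?_
      rw [sub_eq_neg_add, homeo_zpow_add_apply, exy, homeo_zpow_neg_apply_zpow]
      exact hxB
  obtain ⟨T, hT⟩ := hglue
  have good : ∀ x, R x ∉ A → R (R x) ∉ A → (T⁻¹ * S * T) x = R x := by
    intro x h1 h2
    obtain ⟨i, him, hi⟩ := hcovD x h1
    have e1 : ∀ k : ℤ, (R ^ (-(k + 1))) (R x) = (R ^ (-k)) x := by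
      intro k
      rw [show -k = -(k + 1) + 1 by ring, homeo_zpow_add_apply, zpow_one]
    have hRx : R x ∈ D (i + 1) := by
      refine ⟨h2, ?_, fun k hk => ?_⟩
      · push_cast
        rw [e1]
        exact hi.2.1
      · cases k with
        | zero => simpa using h1
        | succ k =>
          push_cast
          rw [e1]
          exact hi.2.2 k (by omega)
    obtain ⟨j, hjm, hj⟩ := hcovD (R x) h2
    have hij : j = i + 1 := by
      rcases lt_trichotomy j (i + 1) with h | h | h
      · exact (hRx.2.2 j h hj.2.1).elim
      · exact h
      · exact (hj.2.2 _ h hRx.2.1).elim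
    have hTR : T (R x) = S (T x) := by
      rw [hT (i + 1) (hij ▸ hjm) _ hRx, hT i him x hi]
      simp only [G, Homeomorph.mul_apply]
      push_cast
      rw [e1, add_comm, homeo_zpow_add_apply, zpow_one]
    rw [Homeomorph.mul_apply, Homeomorph.mul_apply, ← hTR, Homeomorph.inv_apply,
      Homeomorph.symm_apply_apply]
  refine ⟨T, ?_⟩
  rintro x (hx | hx)
  · by_contra h
    simp only [Set.mem_ofPred_eq, not_or] at h
    exact hx (good x h.2.1 h.2.2).symm
  · by_contra h
    simp only [Set.mem_ofPred_eq, not_or] at h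
    refine hx ?_
    -- Agreement of the inverses at `x` is agreement of the maps at `R⁻¹ x`; this is why `A` itself
    -- joins the exceptional set.
    have := good (R⁻¹ x) (by simpa using h.1) (by simpa using h.2.1)
    rw [Homeomorph.inv_apply, Homeomorph.symm_apply_eq, this, Homeomorph.inv_apply,
      Homeomorph.apply_symm_apply]

theorem IsAperiodic.conj {S : X ≃ₜ X} (hS : IsAperiodic S) (T : X ≃ₜ X) :
    IsAperiodic (T⁻¹ * S * T) := by
  intro n hn x h
  have e : (T⁻¹ * S * T) ^ n = T⁻¹ * S ^ n * T := by
    simpa using conj_pow (a := T⁻¹) (b := S) (i := n)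
  rw [e, Homeomorph.mul_apply, Homeomorph.mul_apply, Homeomorph.inv_apply,
    Homeomorph.symm_apply_eq] at h
  exact hS n hn (T x) h

/-! ### The uniform topology -/

theorem diffSet_subset_union (S R T : X ≃ₜ X) : diffSet S T ⊆ diffSet S R ∪ diffSet R T := by
  intro x hx
  simp only [diffSet, Set.mem_union, Set.mem_ofPred_eq] at hx ⊢
  by_contra! h
  obtain ⟨⟨h1, h2⟩, h3, h4⟩ := h
  rcases hx with hx | hx
  · exact hx (h3.trans h1)
  · exact hx (h2.trans h4)

theorem mem_basicNhd_self [MeasurableSpace X] (T : X ≃ₜ X) {p : ℕ}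
    (μ : Fin p → ProbabilityMeasure X) {ε : ℝ} (hε : 0 < ε) : T ∈ basicNhd T μ ε := by
  intro i
  simpa [diffSet] using hε

/-- A basic neighbourhood that contains `R` contains one centred at `R`. -/
theorem exists_basicNhd_subset_basicNhd [MeasurableSpace X] {R T : X ≃ₜ X} {p : ℕ}
    {μ : Fin p → ProbabilityMeasure X} {ε : ℝ} (hR : R ∈ basicNhd T μ ε) :
    ∃ δ : ℝ, 0 < δ ∧ basicNhd R μ δ ⊆ basicNhd T μ ε := by
  obtain ⟨δ, hδ, h⟩ : ∃ δ : ℝ, 0 < δ ∧ ∀ i, δ ≤ ε - (μ i : Measure X).real (diffSet R T) := by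
    rcases isEmpty_or_nonempty (Fin p) with hp | hp
    · exact ⟨1, one_pos, fun i => isEmptyElim i⟩
    · obtain ⟨i, hi⟩ := Finite.exists_min fun i => ε - (μ i : Measure X).real (diffSet R T)
      exact ⟨_, sub_pos.2 (hR i), hi⟩
  refine ⟨δ, hδ, fun S hS i => ?_⟩
  have h1 : (μ i : Measure X).real (diffSet S T) ≤
      (μ i : Measure X).real (diffSet S R) + (μ i : Measure X).real (diffSet R T) :=
    (measureReal_mono (diffSet_subset_union S R T)).trans (measureReal_union_le _ _)
  have h2 := hS i
  have h3 := h i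
  linarith

/-- Finite intersections are absorbed by concatenating the families of measures and taking the
smaller radius, so the subbasic sets centred at `R` form a neighbourhood base there. -/
theorem exists_basicNhd_subset [MeasurableSpace X] {R : X ≃ₜ X} {V : Set (X ≃ₜ X)}
    (hV : IsOpen[uniformTopology X] V) (hR : R ∈ V) :
    ∃ (p : ℕ) (μ : Fin p → ProbabilityMeasure X) (ε : ℝ), 0 < ε ∧ basicNhd R μ ε ⊆ V := by
  induction hV with
  | basic s hs =>
    obtain ⟨T, p, μ, ε, -, rfl⟩ := hs
    obtain ⟨δ, hδ, h⟩ := exists_basicNhd_subset_basicNhd hR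
    exact ⟨p, μ, δ, hδ, h⟩
  | univ => exact ⟨0, fun i => i.elim0, 1, one_pos, Set.subset_univ _⟩
  | inter s t _ _ hs ht =>
    obtain ⟨p, μ, ε, hε, h1⟩ := hs hR.1
    obtain ⟨q, ν, δ, hδ, h2⟩ := ht hR.2
    refine ⟨p + q, Fin.append μ ν, min ε δ, lt_min hε hδ,
      fun S hS => ⟨h1 fun i => ?_, h2 fun i => ?_⟩⟩
    · have := hS (Fin.castAdd q i)
      rw [Fin.append_left] at this
      exact this.trans_le (min_le_left _ _)
    · have := hS (Fin.natAdd p i)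
      rw [Fin.append_right] at this
      exact this.trans_le (min_le_right _ _)
  | sUnion C _ ih =>
    obtain ⟨s, hs, hRs⟩ := hR
    obtain ⟨p, μ, ε, hε, h⟩ := ih s hs hRs
    exact ⟨p, μ, ε, hε, h.trans (Set.subset_sUnion_of_mem hs)⟩

/-- The aperiodic homeomorphisms form a closed set in the uniform topology. -/
theorem isClosed_setOf_isAperiodic [MeasurableSpace X] :
    IsClosed[uniformTopology X] {R : X ≃ₜ X | IsAperiodic R} := by
  let _ := uniformTopology X
  rw [← isOpen_compl_iff, isOpen_iff_forall_mem_open]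
  intro R hR
  simp only [Set.mem_compl_iff, Set.mem_ofPred_eq, IsAperiodic, not_forall, not_not] at hR
  obtain ⟨n, hn, x, hx⟩ := hR
  -- A Dirac mass below `1` on the difference set forces agreement at its point, so every map in
  -- this neighbourhood follows the periodic orbit of `x`.
  let μ : Fin n → ProbabilityMeasure X := fun i =>
    ⟨Measure.dirac ((R ^ (i : ℕ)) x), Measure.dirac.isProbabilityMeasure⟩
  refine ⟨basicNhd R μ 1, ?_, TopologicalSpace.isOpen_generateFrom_of_mem
    ⟨R, n, μ, 1, one_pos, rfl⟩, mem_basicNhd_self R μ one_pos⟩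
  intro Q hQ hQa
  have key : ∀ i < n, Q ((R ^ i) x) = R ((R ^ i) x) := by
    intro i hi
    by_contra hne
    have h1 := hQ ⟨i, hi⟩
    refine h1.ne ?_
    have h2 : (Measure.dirac ((R ^ i) x)) (diffSet Q R) = 1 :=
      Measure.dirac_apply_of_mem (Or.inl (Ne.symm hne))
    change ((Measure.dirac ((R ^ i) x)) (diffSet Q R)).toReal = 1
    rw [h2, ENNReal.toReal_one]
  have hpow : ∀ i ≤ n, (Q ^ i) x = (R ^ i) x := by
    intro i
    induction i with
    | zero => intro; rfl
    | succ i ih =>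
      intro hi
      rw [pow_succ', pow_succ', Homeomorph.mul_apply, Homeomorph.mul_apply, ih (by omega),
        key i hi]
  exact hQa n hn x ((hpow n le_rfl).trans hx)

end Aperiodic

end CantorDynamics

theorem mainTheorem3 {X : Type*} [TopologicalSpace X] [MeasurableSpace X] [BorelSpace X]
    (hX : CantorDynamics.IsCantor X) (S : X ≃ₜ X) (hS : CantorDynamics.IsAperiodic S) :
    (∀ R : X ≃ₜ X, CantorDynamics.IsAperiodic R →
      ∀ (p : ℕ) (μ : Fin p → ProbabilityMeasure X) (ε : ℝ), 0 < ε →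
        ∃ T : X ≃ₜ X, T⁻¹ * S * T ∈ CantorDynamics.basicNhd R μ ε) ∧
    {R : X ≃ₜ X | CantorDynamics.IsAperiodic R} =
      closure[CantorDynamics.uniformTopology X] (Set.range fun T : X ≃ₜ X => T⁻¹ * S * T) := by
  have dense : ∀ R : X ≃ₜ X, CantorDynamics.IsAperiodic R →
      ∀ (p : ℕ) (μ : Fin p → ProbabilityMeasure X) (ε : ℝ), 0 < ε →
        ∃ T : X ≃ₜ X, T⁻¹ * S * T ∈ CantorDynamics.basicNhd R μ ε := by
    intro R hR p μ ε hε
    have := hX.compactSpace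
    have := hX.t2Space
    have := hX.totallyDisconnectedSpace
    obtain ⟨N, A, hN, hA, hdisj, hcov, hμ⟩ := hR.exists_isClopen_marker_measure_lt μ hε
    obtain ⟨T, hT⟩ := hX.exists_conj_diffSet_subset hS hN hA hdisj hcov
    exact ⟨T, fun j => (measureReal_mono hT).trans_lt (hμ j)⟩
  refine ⟨dense, ?_⟩
  let _ := CantorDynamics.uniformTopology X
  apply Set.Subset.antisymm
  · intro R hR
    refine mem_closure_iff.2 fun V hV hRV => ?_
    obtain ⟨p, μ, ε, hε, hsub⟩ := CantorDynamics.exists_basicNhd_subset hV hRV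
    obtain ⟨T, hT⟩ := dense R hR p μ ε hε
    exact ⟨_, hsub hT, T, rfl⟩
  · refine closure_minimal ?_ CantorDynamics.isClosed_setOf_isAperiodic
    rintro _ ⟨T, rfl⟩
    exact hS.conj T
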